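/- Let $\mathcal H_A,\mathcal H_B$ be complex Hilbert spaces of finite dimensions $d_A,d_B$, and let $\mathscr B=\{\mathcal B_x\}_{x=1}^m$, $\mathcal B_x=\{|\psi_{xk}\rangle\}_{k=1}^{d_A}$, be a finite family of orthonormal bases of $\mathcal H_A$. The transition graph of $\mathscr B$ has one vertex $(x,k)$ for each basis state $|\psi_{xk}\rangle$ (equal states in different bases give different vertices), and two different vertices $(x,k)$, $(y,l)$ are adjacent iff $\langle\psi_{xk}|\psi_{yl}\rangle\neq 0$. The family $\mathscr B$ is irreducible if this graph is connected (in particular nonempty). A bipartite state is a positive semidefinite operator of trace one on $\mathcal H_A\otimes\mathcal H_B$ (pure or mixed). A state $\rho$ is a zero-uncertainty state (ZUS) with respect to $\mathscr B$ if for every $x$ there is a POVM $\{\Pi_{xk}\}_{k=1}^{d_A}$ on $\mathcal H_B$ such that $$\sum_{k}\operatorname{tr}\bigl[\rho\,(|\psi_{xk}\rangle\langle\psi_{xk}|\otimes\Pi_{xk})\bigr]=1 .$$ A state $\rho$ on $\mathcal H_A\otimes\mathcal H_B$ is a maximally entangled state (MES) if every state on $\mathcal H_A\otimes\mathcal H_B$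 can be created from $\rho$ by local operations and two-way classical communication (LOCC), with finitely many rounds, finitely many measurement outcomes in each round, and arbitrary finite-dimensional local ancillas. **Theorem.** Suppose $\mathscr B$ is irreducible. Then a bipartite (pure or mixed) state $\rho$ on $\mathcal H_A\otimes\mathcal H_B$ is a ZUS with respect to $\mathscr B$ if and only if $d_B\ge d_A$ and $\rho$ is a MES. -/

import Mathlib

open scoped Matrix Kronecker ComplexOrder

noncomputable section

/-- Operators on the bipartite system `ℂ^a ⊗ ℂ^b`, as matrices in the product basis. -/
abbrev BipartiteOp (a b : ℕ) : Type := Matrix (Fin a × Fin b) (Fin a × Fin b) ℂ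

/-- A bipartite quantum state, pure or mixed: a positive semidefinite operator of trace one. -/
def IsState {a b : ℕ} (ρ : BipartiteOp a b) : Prop :=
  ρ.PosSemidef ∧ ρ.trace = 1

/-- The rank-one operator `|ψ⟩⟨ψ|`. -/
def ketBra {d : ℕ} (ψ : EuclideanSpace ℂ (Fin d)) : Matrix (Fin d) (Fin d) ℂ :=
  Matrix.of fun i j => ψ i * star (ψ j)

/-- A set of `m` orthonormal bases of `ℂ^d`, where `B x k` is the `k`-th vector of basis `x`. -/
abbrev BasisSet (m d : ℕ) : Type :=
  Fin m → OrthonormalBasis (Fin d) ℂ (EuclideanSpace ℂ (Fin d))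

/-- The transition graph of a basis set. The vertices are the `m * d` basis states (equal states
in different bases are different vertices); two different vertices are adjacent iff the
corresponding states are not orthogonal. -/
def transitionGraph {m d : ℕ} (B : BasisSet m d) : SimpleGraph (Fin m × Fin d) where
  Adj v w := v ≠ w ∧ inner ℂ (B v.1 v.2) (B w.1 w.2) ≠ 0
  symm := ⟨fun _ _ h => ⟨h.1.symm, fun h0 => h.2 (inner_eq_zero_symm.mp h0)⟩⟩
  loopless := ⟨fun _ h => h.1 rfl⟩

/-- A basis set is irreducible if its transition graph is connected. -/
def IsIrreducibleBasisSet {m d : ℕ} (B : BasisSet m d) : Prop :=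
  (transitionGraph B).Connected

/-- A POVM on `ℂ^b` with outcomes in `Fin n`. -/
def IsPOVM {n b : ℕ} (E : Fin n → Matrix (Fin b) (Fin b) ℂ) : Prop :=
  (∀ k, (E k).PosSemidef) ∧ ∑ k, E k = 1

/-- The probability `∑ k, tr[ρ (|ψ k⟩⟨ψ k| ⊗ E k)]` that Bob, measuring the POVM `E`, correctly
guesses the outcome of Alice's projective measurement in the orthonormal basis `ψ`. -/
def guessProb {a b : ℕ} (ρ : BipartiteOp a b)
    (ψ : OrthonormalBasis (Fin a) ℂ (EuclideanSpace ℂ (Fin a)))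
    (E : Fin a → Matrix (Fin b) (Fin b) ℂ) : ℂ :=
  ∑ k, (ρ * (ketBra (ψ k) ⊗ₖ E k)).trace

/-- `ρ` is a zero-uncertainty state for `B`: for every basis that Alice may choose, Bob has a
measurement that predicts her outcome with certainty. -/
def IsZUS {m a b : ℕ} (B : BasisSet m a) (ρ : BipartiteOp a b) : Prop :=
  ∀ x, ∃ E : Fin a → Matrix (Fin b) (Fin b) ℂ, IsPOVM E ∧ guessProb ρ (B x) E = 1

/-- The maps from operators on `ℂ^a ⊗ ℂ^b` to operators on `ℂ^c ⊗ ℂ^d` that are implemented by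
local operations and (two-way) classical communication with finitely many rounds.
A protocol either stops, or one party performs a local measurement given by finitely many Kraus
operators `K i` with `∑ i, (K i)ᴴ * K i = 1` (possibly changing the local dimension, so that
ancillas can be added and subsystems discarded) and announces the outcome `i`, after which the
two parties continue with a protocol that may depend on `i`. Outcomes are forgotten at the end.
A general local instrument, with several Kraus operators per outcome, is the case where the
continuation is the same for several values of `i`. -/
inductive IsLOCC {c d : ℕ} : {a b : ℕ} → (BipartiteOp a b → BipartiteOp c d) → Prop
  | done : IsLOCC (a := c) (b := d) (fun ρ => ρ)
  | alice {a b n : ℕ} (dim : Fin n → ℕ) (K : (i : Fin n) → Matrix (Fin (dim i)) (Fin a) ℂ)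
      (hK : ∑ i, (K i)ᴴ * K i = 1)
      (T : (i : Fin n) → BipartiteOp (dim i) b → BipartiteOp c d)
      (hT : ∀ i, IsLOCC (T i)) :
      IsLOCC (a := a) (b := b) (fun ρ => ∑ i, T i
        ((K i ⊗ₖ (1 : Matrix (Fin b) (Fin b) ℂ)) * ρ *
          (K i ⊗ₖ (1 : Matrix (Fin b) (Fin b) ℂ))ᴴ))
  | bob {a b n : ℕ} (dim : Fin n → ℕ) (K : (i : Fin n) → Matrix (Fin (dim i)) (Fin b) ℂ)
      (hK : ∑ i, (K i)ᴴ * K i = 1)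
      (T : (i : Fin n) → BipartiteOp a (dim i) → BipartiteOp c d)
      (hT : ∀ i, IsLOCC (T i)) :
      IsLOCC (a := a) (b := b) (fun ρ => ∑ i, T i
        (((1 : Matrix (Fin a) (Fin a) ℂ) ⊗ₖ K i) * ρ *
          ((1 : Matrix (Fin a) (Fin a) ℂ) ⊗ₖ K i)ᴴ))

/-- A state on `ℂ^a ⊗ ℂ^b` is maximally entangled if every state on `ℂ^a ⊗ ℂ^b` can be created
from it by LOCC. -/
def IsMES {a b : ℕ} (ρ : BipartiteOp a b) : Prop :=
  IsState ρ ∧ ∀ σ : BipartiteOp a b, IsState σ →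
    ∃ T : BipartiteOp a b → BipartiteOp a b, IsLOCC T ∧ T ρ = σ

end

/-! Write the state as `∑ s, vecKetBra (N s)` with mutually orthogonal `N s`. When `dA ≤ dB`, being
a ZUS and being a MES are both equivalent to isotropy: every `(N s)ᴴ * N t` is a scalar matrix.
Orthogonality then kills the scalars with `s ≠ t`, so the nonzero `N s` are multiples of isometries
`W s` with orthogonal ranges. Such an isometry forces `dA ≤ dB`.

ZUS to isotropic: certain prediction lets Bob's effects move through `N s` and become Alice's
transposed projectors, so the transposed Gram matrices commute with all basis projectors.
Irreducibility leaves only scalars.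

MES to isotropic: a separable map sending the state to a pure maximally entangled `J` has each `K i
* N s * (A i)ᵀ` proportional to `J`; the completeness relation recovers the Gram matrices from these
as sums of scalars.

Conversely, Bob can identify `s` without disturbance. He then copies Alice's measurement through `W
s` (ZUS), or the two parties run a teleportation-like protocol (MES). -/

/-! ### Vectorization and ensembles -/

/-- The rank-one operator `|N⟩⟩⟨⟨N|` of the vectorization of a matrix `N`. -/
noncomputable def vecKetBra {a b : ℕ} (N : Matrix (Fin b) (Fin a) ℂ) : BipartiteOp a b :=
  Matrix.vecMulVec N.vec (star N.vec)

theorem vecKetBra_zero {a b : ℕ} : vecKetBra (0 : Matrix (Fin b) (Fin a) ℂ) = 0 := by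
  simp [vecKetBra]

theorem vecKetBra_smul {a b : ℕ} (z : ℂ) (N : Matrix (Fin b) (Fin a) ℂ) :
    vecKetBra (z • N) = (z * star z) • vecKetBra N := by
  ext p q
  simp [vecKetBra, Matrix.vecMulVec_apply]
  ring

/-- Local operators become left and right multiplication; the transpose on Alice's side is the
source of all later ones. -/
theorem kronecker_mul_vecKetBra_mul {a b c d : ℕ} (A : Matrix (Fin c) (Fin a) ℂ)
    (B : Matrix (Fin d) (Fin b) ℂ) (N : Matrix (Fin b) (Fin a) ℂ) :
    (A ⊗ₖ B) * vecKetBra N * (A ⊗ₖ B)ᴴ = vecKetBra (B * N * Aᵀ) := by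
  rw [vecKetBra, vecKetBra, Matrix.mul_vecMulVec, Matrix.vecMulVec_mul, ← Matrix.star_mulVec,
    Matrix.kronecker_mulVec_vec]

theorem trace_vecKetBra {a b : ℕ} (N : Matrix (Fin b) (Fin a) ℂ) :
    (vecKetBra N).trace = (Nᴴ * N).trace := by
  rw [vecKetBra, Matrix.trace_vecMulVec, dotProduct_comm, Matrix.star_vec_dotProduct_vec]

theorem trace_vecKetBra_mul_kronecker {a b : ℕ} (N : Matrix (Fin b) (Fin a) ℂ)
    (A : Matrix (Fin a) (Fin a) ℂ) (B : Matrix (Fin b) (Fin b) ℂ) :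
    (vecKetBra N * (A ⊗ₖ B)).trace = (Nᴴ * (B * N * Aᵀ)).trace := by
  rw [vecKetBra, Matrix.trace_mul_comm, Matrix.mul_vecMulVec, Matrix.trace_vecMulVec,
    dotProduct_comm, Matrix.kronecker_mulVec_vec, Matrix.star_vec_dotProduct_vec]

theorem posSemidef_vecKetBra {a b : ℕ} (N : Matrix (Fin b) (Fin a) ℂ) :
    (vecKetBra N).PosSemidef :=
  Matrix.posSemidef_vecMulVec_self_star _

/-- Spectral decomposition of a positive semidefinite bipartite operator. -/
theorem exists_eq_sum_vecKetBra {a b : ℕ} {ρ : BipartiteOp a b} (hρ : ρ.PosSemidef) :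
    ∃ N : Fin a × Fin b → Matrix (Fin b) (Fin a) ℂ, ρ = ∑ s, vecKetBra (N s) ∧
      ∀ s t, s ≠ t → ((N s)ᴴ * N t).trace = 0 := by
  have hH := hρ.isHermitian
  set U : Matrix (Fin a × Fin b) (Fin a × Fin b) ℂ := hH.eigenvectorUnitary.1 with hU
  have hUU : Uᴴ * U = 1 := Unitary.coe_star_mul_self hH.eigenvectorUnitary
  -- Each term is an eigenvector scaled by the square root of its eigenvalue and reshaped into a
  -- matrix.
  refine ⟨fun s => Matrix.of fun i j => (√(hH.eigenvalues s) : ℂ) * U (j, i) s, ?_, ?_⟩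
  · have h := hH.spectral_theorem
    rw [Unitary.conjStarAlgAut_apply] at h
    ext p q
    conv_lhs => rw [h]
    rw [Matrix.mul_apply, Matrix.sum_apply]
    refine Finset.sum_congr rfl fun s _ => ?_
    have hs : (√(hH.eigenvalues s) : ℂ) * (√(hH.eigenvalues s) : ℂ) = hH.eigenvalues s := by
      rw [← Complex.ofReal_mul, Real.mul_self_sqrt (hρ.eigenvalues_nonneg s)]
    simp only [Matrix.mul_diagonal, Function.comp_apply, vecKetBra, Matrix.vecMulVec_apply,
      Matrix.vec, Matrix.of_apply, Pi.star_apply, star_mul', ← hU, Matrix.star_apply,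
      RCLike.star_def, Complex.conj_ofReal, Prod.mk.eta, Complex.coe_algebraMap]
    rw [← hs]
    ring
  · intro s t hst
    rw [← Matrix.star_vec_dotProduct_vec]
    have h := congrFun (congrFun hUU s) t
    rw [Matrix.one_apply_ne hst, Matrix.mul_apply] at h
    simp only [dotProduct, Pi.star_apply, Matrix.vec, Matrix.of_apply, star_mul', RCLike.star_def,
      Complex.conj_ofReal, Prod.mk.eta]
    simp only [Matrix.conjTranspose_apply, RCLike.star_def] at h
    calc _ = (√(hH.eigenvalues s) : ℂ) * √(hH.eigenvalues t) *
          ∑ p, (starRingEnd ℂ) (U p s) * U p t := by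
          rw [Finset.mul_sum]; exact Finset.sum_congr rfl fun p _ => by ring
      _ = 0 := by rw [h, mul_zero]

theorem trace_conjTranspose_mul_self_nonneg {a b : ℕ} (N : Matrix (Fin b) (Fin a) ℂ) :
    0 ≤ (Nᴴ * N).trace :=
  (Matrix.posSemidef_conjTranspose_mul_self N).trace_nonneg

/-- The terms of an ensemble decomposition of a pure state are multiples of that state. -/
theorem exists_eq_smul_of_sum_vecKetBra_eq {a b : ℕ} {ι : Type*} [Fintype ι]
    {N : ι → Matrix (Fin b) (Fin a) ℂ} {J : Matrix (Fin b) (Fin a) ℂ}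
    (hJ : (Jᴴ * J).trace = 1) (h : ∑ i, vecKetBra (N i) = vecKetBra J) (i : ι) :
    ∃ c : ℂ, N i = c • J := by
  -- In the direction `X`, the sum of the squared overlaps with all `N j` equals that with `J`,
  -- which is zero. So `N i` has no component orthogonal to `J`.
  have key : ∀ X : Matrix (Fin b) (Fin a) ℂ, (Xᴴ * J).trace = 0 → (Xᴴ * N i).trace = 0 := by
    intro X hX
    have h2 := congrArg (fun R => star X.vec ⬝ᵥ (R *ᵥ X.vec)) h
    simp only [vecKetBra, Matrix.sum_mulVec, dotProduct_sum, Matrix.vecMulVec_mulVec,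
      dotProduct_smul, MulOpposite.smul_eq_mul_unop, MulOpposite.unop_op] at h2
    simp only [Matrix.star_vec_dotProduct_vec, hX, zero_mul] at h2
    have hc : ∀ j, ((N j)ᴴ * X).trace = star (Xᴴ * N j).trace := fun j => by
      rw [← Matrix.trace_conjTranspose, Matrix.conjTranspose_mul, Matrix.conjTranspose_conjTranspose]
    simp only [hc] at h2
    have h3 := (Finset.sum_eq_zero_iff_of_nonneg fun j _ => mul_star_self_nonneg _).1 h2 i
      (Finset.mem_univ i)
    simpa using h3
  refine ⟨(Jᴴ * N i).trace, ?_⟩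
  set X := N i - (Jᴴ * N i).trace • J with hX
  have hXJ : (Xᴴ * J).trace = 0 := by
    have : (Jᴴ * X).trace = 0 := by
      rw [hX, Matrix.mul_sub, Matrix.trace_sub, Matrix.mul_smul, Matrix.trace_smul, hJ]
      simp
    rw [← star_eq_zero, ← Matrix.trace_conjTranspose]
    simpa using this
  have hXX : (Xᴴ * X).trace = 0 := by
    conv_lhs => rw [hX, Matrix.mul_sub, Matrix.trace_sub, Matrix.mul_smul, Matrix.trace_smul]
    rw [key X hXJ, hXJ]
    simp
  have := (Matrix.trace_conjTranspose_mul_self_eq_zero_iff).1 hXX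
  exact sub_eq_zero.1 this

/-! ### Zero uncertainty implies isotropy -/

/-- The Gram matrices `(N s)ᴴ * N t` of the ensemble are multiples of the identity. -/
def IsIsotropicEnsemble {a b : ℕ} {ι : Type*} (N : ι → Matrix (Fin b) (Fin a) ℂ) : Prop :=
  ∀ s t, ∃ c : ℂ, (N s)ᴴ * N t = c • (1 : Matrix (Fin a) (Fin a) ℂ)

theorem ketBra_eq_vecMulVec {d : ℕ} (ψ : EuclideanSpace ℂ (Fin d)) :
    ketBra ψ = Matrix.vecMulVec ψ.ofLp (star ψ.ofLp) := rfl

theorem star_dotProduct_ofLp {d : ℕ} (φ ψ : EuclideanSpace ℂ (Fin d)) :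
    star φ.ofLp ⬝ᵥ ψ.ofLp = inner ℂ φ ψ := by
  rw [EuclideanSpace.inner_eq_star_dotProduct, dotProduct_comm]

theorem OrthonormalBasis.sum_ketBra {d : ℕ}
    (ψ : OrthonormalBasis (Fin d) ℂ (EuclideanSpace ℂ (Fin d))) : ∑ k, ketBra (ψ k) = 1 := by
  refine Matrix.ext_of_mulVec_single fun i => ?_
  have h := ψ.sum_repr' (WithLp.toLp 2 (Pi.single i (1 : ℂ)))
  have h2 := congrArg WithLp.ofLp h
  rw [Matrix.sum_mulVec, Matrix.one_mulVec]
  simp only [ketBra_eq_vecMulVec, Matrix.vecMulVec_mulVec]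
  rw [WithLp.ofLp_sum] at h2
  convert h2 using 2 with k
  rw [← star_dotProduct_ofLp]
  ext j
  simp [mul_comm]

theorem transpose_ketBra {d : ℕ} (ψ : EuclideanSpace ℂ (Fin d)) :
    (ketBra ψ)ᵀ = Matrix.vecMulVec (star ψ.ofLp) (star (star ψ.ofLp)) := by
  ext i j
  simp [ketBra_eq_vecMulVec, Matrix.vecMulVec_apply, mul_comm]

theorem conjTranspose_transpose_ketBra {d : ℕ} (ψ : EuclideanSpace ℂ (Fin d)) :
    ((ketBra ψ)ᵀ)ᴴ = (ketBra ψ)ᵀ := by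
  rw [transpose_ketBra, Matrix.conjTranspose_vecMulVec, star_star]

/-- After Alice finds `ψ`, Bob holds the unnormalized vector `N *ᵥ star ψ`; the trace is the
expectation of `E` in it. -/
theorem trace_vecKetBra_mul_ketBra_kronecker {a b : ℕ} (N : Matrix (Fin b) (Fin a) ℂ)
    (ψ : EuclideanSpace ℂ (Fin a)) (E : Matrix (Fin b) (Fin b) ℂ) :
    (vecKetBra N * (ketBra ψ ⊗ₖ E)).trace =
      star (N *ᵥ star ψ.ofLp) ⬝ᵥ E *ᵥ (N *ᵥ star ψ.ofLp) := by
  rw [trace_vecKetBra_mul_kronecker, transpose_ketBra, Matrix.mul_vecMulVec,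
    Matrix.mul_vecMulVec, Matrix.trace_vecMulVec, dotProduct_comm, Matrix.star_mulVec,
    ← Matrix.dotProduct_mulVec, star_star, ← Matrix.mulVec_mulVec]

/-- Certain prediction: Bob's effect `E l` acts on the state like Alice's projector. -/
theorem povm_mul_eq_mul_transpose_ketBra {a b : ℕ} {ι : Type*} [Fintype ι]
    {N : ι → Matrix (Fin b) (Fin a) ℂ} (hN : (∑ s, vecKetBra (N s)).trace = 1)
    {ψ : OrthonormalBasis (Fin a) ℂ (EuclideanSpace ℂ (Fin a))}
    {E : Fin a → Matrix (Fin b) (Fin b) ℂ} (hE : IsPOVM E)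
    (h : guessProb (∑ s, vecKetBra (N s)) ψ E = 1) (l : Fin a) (s : ι) :
    E l * N s = N s * (ketBra (ψ l))ᵀ := by
  set q : Fin a → Fin a → ι → ℂ := fun k l s =>
    star (N s *ᵥ star (ψ k).ofLp) ⬝ᵥ E l *ᵥ (N s *ᵥ star (ψ k).ofLp) with hq
  have hq0 : ∀ k l s, 0 ≤ q k l s := fun k l s => (hE.1 l).dotProduct_mulVec_nonneg _
  have hf : ∀ k l, ((∑ s, vecKetBra (N s)) * (ketBra (ψ k) ⊗ₖ E l)).trace = ∑ s, q k l s := by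
    intro k l
    rw [Finset.sum_mul, Matrix.trace_sum]
    exact Finset.sum_congr rfl fun s _ => trace_vecKetBra_mul_ketBra_kronecker _ _ _
  have hdiag : ∑ k, ∑ s, q k k s = 1 := by
    rw [← h, guessProb]
    exact Finset.sum_congr rfl fun k _ => (hf k k).symm
  have hone : ∑ k, ∑ l, (ketBra (ψ k) ⊗ₖ E l) = (1 : BipartiteOp a b) := by
    rw [← Matrix.one_kronecker_one, ← ψ.sum_ketBra, ← hE.2]
    ext p r
    simp only [Matrix.sum_apply, Matrix.kroneckerMap_apply, Finset.sum_mul_sum]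
  have hall : ∑ k, ∑ l, ∑ s, q k l s = 1 := by
    simp_rw [← hf, ← Matrix.trace_sum, ← Finset.mul_sum, hone, mul_one, hN]
  -- The correct guesses already have total probability one, so nothing remains for the wrong ones.
  have hoff : ∑ k, ∑ l ∈ Finset.univ.erase k, ∑ s, q k l s = 0 := by
    have : ∑ k, ((∑ s, q k k s) + ∑ l ∈ Finset.univ.erase k, ∑ s, q k l s) = 1 := by
      rw [← hall]
      exact Finset.sum_congr rfl fun k _ =>
        Finset.add_sum_erase _ (fun l => ∑ s, q k l s) (Finset.mem_univ k)
    rw [Finset.sum_add_distrib, hdiag] at this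
    simpa using this
  have hzero : ∀ k l s, l ≠ k → E l *ᵥ (N s *ᵥ star (ψ k).ofLp) = 0 := by
    intro k l s hlk
    have h1 := (Finset.sum_eq_zero_iff_of_nonneg fun k _ => Finset.sum_nonneg fun l _ =>
      Finset.sum_nonneg fun s _ => hq0 k l s).1 hoff k (Finset.mem_univ k)
    have h2 := (Finset.sum_eq_zero_iff_of_nonneg fun l _ =>
      Finset.sum_nonneg fun s _ => hq0 k l s).1 h1 l (by simp [hlk])
    have h3 := (Finset.sum_eq_zero_iff_of_nonneg fun s _ => hq0 k l s).1 h2 s (Finset.mem_univ s)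
    exact ((hE.1 l).dotProduct_mulVec_zero_iff _).1 h3
  have hself : ∀ k, E k *ᵥ (N s *ᵥ star (ψ k).ofLp) = N s *ᵥ star (ψ k).ofLp := by
    intro k
    have : ∑ l, E l *ᵥ (N s *ᵥ star (ψ k).ofLp) = N s *ᵥ star (ψ k).ofLp := by
      rw [← Matrix.sum_mulVec, hE.2, Matrix.one_mulVec]
    rwa [Finset.sum_eq_single k (fun l _ hl => hzero k l s hl) (by simp)] at this
  have hsum : ∑ k, (ketBra (ψ k))ᵀ = 1 := by
    rw [← Matrix.transpose_sum, ψ.sum_ketBra, Matrix.transpose_one]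
  calc E l * N s = ∑ k, E l * N s * (ketBra (ψ k))ᵀ := by
        rw [← Matrix.mul_sum, hsum, Matrix.mul_one]
    _ = E l * N s * (ketBra (ψ l))ᵀ := by
        refine Finset.sum_eq_single l (fun k _ hk => ?_) (by simp)
        rw [transpose_ketBra, Matrix.mul_vecMulVec, ← Matrix.mulVec_mulVec, hzero k l s hk.symm,
          Matrix.zero_vecMulVec]
    _ = N s * (ketBra (ψ l))ᵀ := by
        rw [transpose_ketBra, Matrix.mul_vecMulVec, ← Matrix.mulVec_mulVec, hself,
          Matrix.mul_vecMulVec]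

/-- The commutant of the projectors of an irreducible basis set is trivial. -/
theorem IsIrreducibleBasisSet.exists_eq_smul_one {m d : ℕ} {B : BasisSet m d}
    (hB : IsIrreducibleBasisSet B) {Y : Matrix (Fin d) (Fin d) ℂ}
    (hY : ∀ x k, Y * ketBra (B x k) = ketBra (B x k) * Y) : ∃ c : ℂ, Y = c • 1 := by
  set u : Fin m × Fin d → Fin d → ℂ := fun v => (B v.1 v.2).ofLp with hu
  set y : Fin m × Fin d → ℂ := fun v => star (u v) ⬝ᵥ Y *ᵥ u v with hy
  have hnorm : ∀ v, star (u v) ⬝ᵥ u v = 1 := fun v => by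
    rw [hu, star_dotProduct_ofLp, inner_self_eq_norm_sq_to_K, (B v.1).norm_eq_one]
    simp
  have hcomm : ∀ v, Matrix.vecMulVec (Y *ᵥ u v) (star (u v)) =
      Matrix.vecMulVec (u v) (star (u v) ᵥ* Y) := fun v => by
    rw [← Matrix.mul_vecMulVec, ← Matrix.vecMulVec_mul]
    exact hY v.1 v.2
  -- Commuting with a rank-one projector makes its vector a right and a left eigenvector with one
  -- common eigenvalue.
  have hright : ∀ v, Y *ᵥ u v = y v • u v := fun v => by
    have h := congrArg (· *ᵥ u v) (hcomm v)
    simp only [Matrix.vecMulVec_mulVec, hnorm, ← Matrix.dotProduct_mulVec] at h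
    simpa using h
  have hleft : ∀ v, star (u v) ᵥ* Y = y v • star (u v) := fun v => by
    have h := congrArg (star (u v) ᵥ* ·) (hcomm v)
    simp only [Matrix.vecMul_vecMulVec, hnorm] at h
    simpa using h.symm
  -- The matrix element of `Y` between `u v` and `u w`, computed from either side, equates the
  -- eigenvalues along an edge.
  have hadj : ∀ v w, (transitionGraph B).Adj v w → y v = y w := by
    intro v w hvw
    have hne : star (u v) ⬝ᵥ u w ≠ 0 := by
      rw [hu, star_dotProduct_ofLp]; exact hvw.2
    have h : star (u v) ⬝ᵥ Y *ᵥ u w = star (u v) ᵥ* Y ⬝ᵥ u w := Matrix.dotProduct_mulVec _ _ _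
    rw [hright, hleft, dotProduct_smul, smul_dotProduct] at h
    exact (mul_right_cancel₀ hne h).symm
  obtain ⟨v₀⟩ := hB.nonempty
  have hconst : ∀ v, y v = y v₀ := by
    intro v
    obtain ⟨p⟩ := hB.preconnected v v₀
    induction p with
    | nil => rfl
    | cons h _ ih => rw [hadj _ _ h, ih]
  refine ⟨y v₀, ?_⟩
  calc Y = ∑ k, Y * ketBra (B v₀.1 k) := by
        rw [← Finset.mul_sum, (B v₀.1).sum_ketBra, Matrix.mul_one]
    _ = ∑ k, y v₀ • ketBra (B v₀.1 k) := Finset.sum_congr rfl fun k _ => by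
        have := hright (v₀.1, k)
        rw [hconst] at this
        rw [ketBra_eq_vecMulVec, Matrix.mul_vecMulVec, this, Matrix.smul_vecMulVec]
    _ = y v₀ • 1 := by rw [← Finset.smul_sum, (B v₀.1).sum_ketBra]

/-- `(N t)ᴴ * E k * N s` is evaluated in two ways: the Hermitian effect `E k` can be absorbed to the
right or to the left. -/
theorem IsZUS.isIsotropicEnsemble {m a b : ℕ} {ι : Type*} [Fintype ι] {B : BasisSet m a}
    (hB : IsIrreducibleBasisSet B) {N : ι → Matrix (Fin b) (Fin a) ℂ}
    (hN : (∑ s, vecKetBra (N s)).trace = 1) (h : IsZUS B (∑ s, vecKetBra (N s))) :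
    IsIsotropicEnsemble N := by
  intro t s
  have hcomm : ∀ x k, ((N t)ᴴ * N s)ᵀ * ketBra (B x k) = ketBra (B x k) * ((N t)ᴴ * N s)ᵀ := by
    intro x k
    obtain ⟨E, hE, hg⟩ := h x
    have h1 := povm_mul_eq_mul_transpose_ketBra hN hE hg k s
    have h2 := congrArg Matrix.conjTranspose (povm_mul_eq_mul_transpose_ketBra hN hE hg k t)
    rw [Matrix.conjTranspose_mul, Matrix.conjTranspose_mul, (hE.1 k).isHermitian.eq,
      conjTranspose_transpose_ketBra] at h2
    apply Matrix.transpose_injective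
    rw [Matrix.transpose_mul _ (ketBra (B x k)), Matrix.transpose_mul (ketBra (B x k)),
      Matrix.transpose_transpose, ← Matrix.mul_assoc, ← h2, Matrix.mul_assoc, h1, Matrix.mul_assoc]
  obtain ⟨c, hc⟩ := hB.exists_eq_smul_one hcomm
  refine ⟨c, ?_⟩
  rw [← Matrix.transpose_transpose ((N t)ᴴ * N s), hc, Matrix.transpose_smul, Matrix.transpose_one]

/-! ### LOCC protocols -/

/-- A one-way protocol: Bob measures and announces his outcome, and Alice applies an isometry
that depends on it. -/
theorem isLOCC_of_isometry_kronecker {a b c d : ℕ} {ι : Type*} [Fintype ι]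
    (U : ι → Matrix (Fin c) (Fin a) ℂ) (K : ι → Matrix (Fin d) (Fin b) ℂ)
    (hU : ∀ i, (U i)ᴴ * U i = 1) (hK : ∑ i, (K i)ᴴ * K i = 1) :
    IsLOCC (fun ρ : BipartiteOp a b => ∑ i, (U i ⊗ₖ K i) * ρ * (U i ⊗ₖ K i)ᴴ) := by
  let e := Fintype.equivFin ι
  have h := IsLOCC.bob (c := c) (d := d) (a := a) (fun _ => d) (fun i => K (e.symm i))
    (by rw [← hK]; exact e.symm.sum_comp fun i => (K i)ᴴ * K i) _
    -- An isometry is a measurement with a single outcome.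
    (fun i => IsLOCC.alice (n := 1) (fun _ => c) (fun _ => U (e.symm i)) (by simp [hU]) _
      fun _ => IsLOCC.done)
  convert h using 2 with ρ
  rw [← e.symm.sum_comp]
  refine Finset.sum_congr rfl fun i _ => ?_
  have hUK : U (e.symm i) ⊗ₖ K (e.symm i) =
      (U (e.symm i) ⊗ₖ (1 : Matrix (Fin d) (Fin d) ℂ)) *
        ((1 : Matrix (Fin a) (Fin a) ℂ) ⊗ₖ K (e.symm i)) := by
    rw [← Matrix.mul_kronecker_mul, Matrix.mul_one, Matrix.one_mul]
  rw [hUK, Matrix.conjTranspose_mul]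
  simp only [Fin.sum_univ_one, Matrix.mul_assoc]

/-- LOCC maps are separable. -/
theorem IsLOCC.exists_separable {a b c d : ℕ} {T : BipartiteOp a b → BipartiteOp c d}
    (hT : IsLOCC T) :
    ∃ (ι : Type) (_ : Fintype ι) (A : ι → Matrix (Fin c) (Fin a) ℂ)
      (K : ι → Matrix (Fin d) (Fin b) ℂ),
      ∑ i, ((A i)ᴴ * A i) ⊗ₖ ((K i)ᴴ * K i) = 1 ∧
        ∀ ρ, T ρ = ∑ i, (A i ⊗ₖ K i) * ρ * (A i ⊗ₖ K i)ᴴ := by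
  induction hT with
  | done => exact ⟨Unit, inferInstance, fun _ => 1, fun _ => 1, by simp, by simp⟩
  | @alice a b n dim L hL T _ ih =>
    choose ι hι A K h1 h2 using ih
    refine ⟨Σ i, ι i, inferInstance, fun j => A j.1 j.2 * L j.1, fun j => K j.1 j.2, ?_, ?_⟩
    · rw [Fintype.sum_sigma, ← Matrix.one_kronecker_one, ← hL]
      -- The completeness relation of the `i`-th continuation, sandwiched between the first-round
      -- Kraus operator and its adjoint.
      have : ∀ i, ∑ j, ((A i j * L i)ᴴ * (A i j * L i)) ⊗ₖ ((K i j)ᴴ * K i j) =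
          ((L i)ᴴ * L i) ⊗ₖ (1 : Matrix (Fin b) (Fin b) ℂ) := by
        intro i
        have h : ((L i)ᴴ ⊗ₖ (1 : Matrix (Fin b) (Fin b) ℂ)) *
            (∑ j, ((A i j)ᴴ * A i j) ⊗ₖ ((K i j)ᴴ * K i j)) *
            (L i ⊗ₖ (1 : Matrix (Fin b) (Fin b) ℂ)) =
            ((L i)ᴴ * L i) ⊗ₖ (1 : Matrix (Fin b) (Fin b) ℂ) := by
          rw [h1, Matrix.mul_one, ← Matrix.mul_kronecker_mul, Matrix.one_mul]
        rw [← h, Matrix.mul_sum, Matrix.sum_mul]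
        refine Finset.sum_congr rfl fun j _ => ?_
        rw [← Matrix.mul_kronecker_mul, ← Matrix.mul_kronecker_mul, Matrix.one_mul, Matrix.mul_one,
          Matrix.conjTranspose_mul]
        simp only [Matrix.mul_assoc]
      simp only [this]
      ext p r
      simp only [Matrix.sum_apply, Matrix.kroneckerMap_apply, Finset.sum_mul]
    · intro ρ
      rw [Fintype.sum_sigma]
      refine Finset.sum_congr rfl fun i _ => ?_
      rw [h2]
      refine Finset.sum_congr rfl fun j _ => ?_
      have : (A i j * L i) ⊗ₖ K i j =
          (A i j ⊗ₖ K i j) * (L i ⊗ₖ (1 : Matrix (Fin b) (Fin b) ℂ)) := by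
        rw [← Matrix.mul_kronecker_mul, Matrix.mul_one]
      rw [this, Matrix.conjTranspose_mul]
      simp only [Matrix.mul_assoc]
  | @bob a b n dim L hL T _ ih =>
    choose ι hι A K h1 h2 using ih
    refine ⟨Σ i, ι i, inferInstance, fun j => A j.1 j.2, fun j => K j.1 j.2 * L j.1, ?_, ?_⟩
    · rw [Fintype.sum_sigma, ← Matrix.one_kronecker_one, ← hL]
      have : ∀ i, ∑ j, ((A i j)ᴴ * A i j) ⊗ₖ ((K i j * L i)ᴴ * (K i j * L i)) =
          (1 : Matrix (Fin a) (Fin a) ℂ) ⊗ₖ ((L i)ᴴ * L i) := by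
        intro i
        have h : ((1 : Matrix (Fin a) (Fin a) ℂ) ⊗ₖ (L i)ᴴ) *
            (∑ j, ((A i j)ᴴ * A i j) ⊗ₖ ((K i j)ᴴ * K i j)) *
            ((1 : Matrix (Fin a) (Fin a) ℂ) ⊗ₖ L i) =
            (1 : Matrix (Fin a) (Fin a) ℂ) ⊗ₖ ((L i)ᴴ * L i) := by
          rw [h1, Matrix.mul_one, ← Matrix.mul_kronecker_mul, Matrix.one_mul]
        rw [← h, Matrix.mul_sum, Matrix.sum_mul]
        refine Finset.sum_congr rfl fun j _ => ?_
        rw [← Matrix.mul_kronecker_mul, ← Matrix.mul_kronecker_mul, Matrix.one_mul, Matrix.mul_one,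
          Matrix.conjTranspose_mul]
        simp only [Matrix.mul_assoc]
      simp only [this]
      ext p r
      simp only [Matrix.sum_apply, Matrix.kroneckerMap_apply, Finset.mul_sum]
    · intro ρ
      rw [Fintype.sum_sigma]
      refine Finset.sum_congr rfl fun i _ => ?_
      rw [h2]
      refine Finset.sum_congr rfl fun j _ => ?_
      have : A i j ⊗ₖ (K i j * L i) =
          (A i j ⊗ₖ K i j) * ((1 : Matrix (Fin a) (Fin a) ℂ) ⊗ₖ L i) := by
        rw [← Matrix.mul_kronecker_mul, Matrix.mul_one]
      rw [this, Matrix.conjTranspose_mul]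
      simp only [Matrix.mul_assoc]

/-! ### Weyl operators -/

/-- The Weyl operators of `ℂ^a` form a unitary 1-design. -/
theorem exists_unitary_oneDesign (a : ℕ) [NeZero a] :
    ∃ V : Fin a × Fin a → Matrix (Fin a) (Fin a) ℂ, (∀ j, (V j)ᴴ * V j = 1) ∧
      ∀ X : Matrix (Fin a) (Fin a) ℂ, ∑ j, (V j)ᴴ * X * V j = (a * X.trace) • 1 := by
  set ω : ℂ := Complex.exp (2 * Real.pi * Complex.I / a) with hωdef
  have hω : IsPrimitiveRoot ω a := Complex.isPrimitiveRoot_exp a (NeZero.ne a)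
  have hωω : star ω * ω = 1 := by
    rw [RCLike.star_def, RCLike.conj_mul, hω.norm'_eq_one (NeZero.ne a)]
    simp
  have hpow : ∀ n : ℕ, star (ω ^ n) * ω ^ n = 1 := fun n => by
    rw [star_pow, ← mul_pow, hωω, one_pow]
  -- Orthogonality of characters: for `k ≠ l` this is a geometric sum of a nontrivial `a`-th root of
  -- unity.
  have hsum : ∀ k l : Fin a, ∑ q : Fin a, star (ω ^ (q.1 * k.1)) * ω ^ (q.1 * l.1) =
      if k = l then (a : ℂ) else 0 := by
    intro k l
    split_ifs with hkl
    · subst hkl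
      simp only [hpow]
      simp
    · set z : ℂ := star (ω ^ k.1) * ω ^ l.1 with hz
      have hza : z ^ a = 1 := by
        rw [hz, mul_pow, ← star_pow, ← pow_mul, ← pow_mul, mul_comm k.1, mul_comm l.1, pow_mul,
          pow_mul, hω.pow_eq_one]
        simp
      have hz1 : z ≠ 1 := by
        intro h
        apply hkl
        apply Fin.ext
        apply hω.pow_inj k.2 l.2
        calc ω ^ k.1 = ω ^ k.1 * z := by rw [h, mul_one]
          _ = (star (ω ^ k.1) * ω ^ k.1) * ω ^ l.1 := by rw [hz]; ring
          _ = ω ^ l.1 := by rw [hpow, one_mul]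
      have hterm : ∀ q : Fin a, star (ω ^ (q.1 * k.1)) * ω ^ (q.1 * l.1) = z ^ q.1 := fun q => by
        rw [hz, mul_pow, ← star_pow, ← pow_mul, ← pow_mul, mul_comm q.1, mul_comm q.1]
      simp only [hterm]
      rw [Fin.sum_univ_eq_sum_range (fun n => z ^ n) a]
      have := geom_sum_mul z a
      rw [hza, sub_self] at this
      exact (mul_eq_zero.1 this).resolve_right (sub_ne_zero.2 hz1)
  -- Shift by `j.1` (modulo `a`) after a phase of frequency `j.2`. Summing over phases removes
  -- off-diagonal entries; summing over shifts turns the diagonal into the trace.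
  refine ⟨fun j => Matrix.of fun i k => if i = k + j.1 then ω ^ (j.2.1 * k.1) else 0, ?_, ?_⟩
  · intro j
    ext k l
    simp only [Matrix.mul_apply, Matrix.conjTranspose_apply, Matrix.of_apply, apply_ite star,
      star_zero, mul_ite, ite_mul, zero_mul, mul_zero, Finset.sum_ite_eq', Finset.mem_univ, if_true,
      Matrix.one_apply, add_left_inj]
    by_cases hkl : k = l
    · subst hkl
      simp only [if_true, hpow]
    · simp [hkl, Ne.symm hkl]
  · intro X
    ext k l
    have hentry : ∀ j : Fin a × Fin a,
        ((Matrix.of fun i k => if i = k + j.1 then ω ^ (j.2.1 * k.1) else 0)ᴴ * X *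
          (Matrix.of fun i k => if i = k + j.1 then ω ^ (j.2.1 * k.1) else 0)) k l =
        X (k + j.1) (l + j.1) * (star (ω ^ (j.2.1 * k.1)) * ω ^ (j.2.1 * l.1)) := by
      intro j
      simp only [Matrix.mul_apply, Matrix.conjTranspose_apply, Matrix.of_apply, apply_ite star,
        star_zero, mul_ite, ite_mul, zero_mul, mul_zero, Finset.sum_ite_eq', Finset.mem_univ,
        if_true]
      ring
    rw [Matrix.sum_apply]
    simp only [hentry, Fintype.sum_prod_type, ← Finset.mul_sum, hsum]
    by_cases hkl : k = l
    · subst hkl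
      simp only [if_true, Matrix.smul_apply, Matrix.one_apply_eq, smul_eq_mul, mul_one,
        ← Finset.sum_mul, Matrix.trace, Matrix.diag]
      rw [mul_comm]
      congr 1
      exact Equiv.sum_comp (Equiv.addLeft k) fun i => X i i
    · simp [hkl]

/-! ### Mixtures of distinguishable isometries -/

/-- An isotropic ensemble of mutually orthogonal terms is a mixture of maximally entangled states
that Bob can tell apart: the `W s` are isometries with mutually orthogonal ranges. -/
theorem IsIsotropicEnsemble.exists_isometries {a b : ℕ} [NeZero a] {ι : Type} [Fintype ι]
    {N : ι → Matrix (Fin b) (Fin a) ℂ} (hN : IsIsotropicEnsemble N)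
    (horth : ∀ s t, s ≠ t → ((N s)ᴴ * N t).trace = 0) :
    ∃ (κ : Type) (_ : Fintype κ) (_ : DecidableEq κ) (c : κ → ℂ)
      (W : κ → Matrix (Fin b) (Fin a) ℂ),
      (∀ s t, (W s)ᴴ * W t = if s = t then 1 else 0) ∧
        ∑ s, vecKetBra (N s) = ∑ s, c s • vecKetBra (W s) := by
  classical
  have ha : (a : ℂ) ≠ 0 := Nat.cast_ne_zero.2 (NeZero.ne a)
  have hoff : ∀ s t, s ≠ t → (N s)ᴴ * N t = 0 := by
    intro s t hst
    obtain ⟨c, hc⟩ := hN s t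
    have h := horth s t hst
    rw [hc, Matrix.trace_smul, Matrix.trace_one, Fintype.card_fin, smul_eq_mul] at h
    rw [hc, (mul_eq_zero.1 h).resolve_right ha, zero_smul]
  have hdiag : ∀ s, N s ≠ 0 → ∃ r : ℝ, 0 < r ∧ (N s)ᴴ * N s = (r : ℂ) • 1 := by
    intro s hs
    obtain ⟨c, hc⟩ := hN s s
    have htr : ((N s)ᴴ * N s).trace = c * a := by
      rw [hc, Matrix.trace_smul, Matrix.trace_one, Fintype.card_fin, smul_eq_mul]
    have hpos : 0 < c * a := by
      rw [← htr]
      exact lt_of_le_of_ne (trace_conjTranspose_mul_self_nonneg _)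
        fun h => hs (Matrix.trace_conjTranspose_mul_self_eq_zero_iff.1 h.symm)
    have hcpos : 0 < c := by
      have h := mul_pos hpos (inv_pos.2 (Nat.cast_pos.2 (NeZero.pos a) : (0 : ℂ) < a))
      rwa [mul_assoc, mul_inv_cancel₀ ha, mul_one] at h
    obtain ⟨hre, him⟩ := Complex.pos_iff.1 hcpos
    refine ⟨c.re, hre, ?_⟩
    rw [hc]
    congr 1
    exact Complex.ext rfl him.symm
  choose r hr hNr using fun s : {s // N s ≠ 0} => hdiag s.1 s.2
  have hsq : ∀ s, (√(r s) : ℂ) * √(r s) = r s := fun s => by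
    rw [← Complex.ofReal_mul, Real.mul_self_sqrt (hr s).le]
  have hsq0 : ∀ s, (√(r s) : ℂ) ≠ 0 := fun s => by
    simpa using (Real.sqrt_pos.2 (hr s)).ne'
  -- Zero terms are dropped, since they cannot be normalized to isometries.
  refine ⟨{s // N s ≠ 0}, inferInstance, inferInstance, fun s => r s,
    fun s => (√(r s) : ℂ)⁻¹ • N s, ?_, ?_⟩
  · intro s t
    rw [Matrix.conjTranspose_smul, Matrix.smul_mul, Matrix.mul_smul]
    split_ifs with hst
    · subst hst
      rw [hNr, smul_smul, smul_smul, ← hsq, star_inv₀, RCLike.star_def, Complex.conj_ofReal]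
      have := hsq0 s
      field_simp
      simp
    · rw [hoff _ _ fun h => hst (Subtype.ext h), smul_zero, smul_zero]
  · have hterm : ∀ s : {s // N s ≠ 0},
        (r s : ℂ) • vecKetBra ((√(r s) : ℂ)⁻¹ • N s) = vecKetBra (N s) := by
      intro s
      rw [vecKetBra_smul, smul_smul, ← hsq, star_inv₀, RCLike.star_def, Complex.conj_ofReal]
      have := hsq0 s
      field_simp
      simp
    simp only [hterm]
    rw [← Fintype.sum_subtype_add_sum_subtype (fun s => N s ≠ 0) fun s => vecKetBra (N s)]
    refine add_eq_left.2 (Finset.sum_eq_zero fun s _ => ?_)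
    rw [not_not.1 s.2, vecKetBra_zero]

section Isometries

variable {a b : ℕ} {κ : Type} [Fintype κ] [DecidableEq κ] {c : κ → ℂ}
  {W : κ → Matrix (Fin b) (Fin a) ℂ}

theorem le_of_conjTranspose_mul_self_eq_one {W : Matrix (Fin b) (Fin a) ℂ} (hW : Wᴴ * W = 1) :
    a ≤ b := by
  have h := Matrix.rank_mul_le_right Wᴴ W
  rw [hW, Matrix.rank_one, Fintype.card_fin] at h
  exact h.trans (by simpa using W.rank_le_height)

theorem trace_sum_smul_vecKetBra (hW : ∀ s t, (W s)ᴴ * W t = if s = t then 1 else 0) :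
    (∑ s, c s • vecKetBra (W s)).trace = a * ∑ s, c s := by
  simp [Matrix.trace_sum, trace_vecKetBra, hW, ← Finset.sum_mul, mul_comm]

theorem sum_mul_conjTranspose_mul (hW : ∀ s t, (W s)ᴴ * W t = if s = t then 1 else 0) (s : κ) :
    (∑ t, W t * (W t)ᴴ) * W s = W s := by
  rw [Matrix.sum_mul, Finset.sum_eq_single s
    (fun t _ ht => by rw [Matrix.mul_assoc, hW, if_neg ht, Matrix.mul_zero]) (by simp),
    Matrix.mul_assoc, hW, if_pos rfl, Matrix.mul_one]

/-- The sum projects onto the span of the orthogonal ranges, so its complement is again a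
projection. It can thus complete both a POVM and a family of Kraus operators. -/
theorem conjTranspose_mul_self_one_sub_sum
    (hW : ∀ s t, (W s)ᴴ * W t = if s = t then 1 else 0) :
    (1 - ∑ t, W t * (W t)ᴴ)ᴴ * (1 - ∑ t, W t * (W t)ᴴ) = 1 - ∑ t, W t * (W t)ᴴ := by
  have hH : (∑ t, W t * (W t)ᴴ)ᴴ = ∑ t, W t * (W t)ᴴ := by
    simp [Matrix.conjTranspose_sum]
  have hG : (∑ t, W t * (W t)ᴴ) * (∑ t, W t * (W t)ᴴ) = ∑ t, W t * (W t)ᴴ := by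
    conv_lhs => rw [Matrix.mul_sum]
    simp only [← Matrix.mul_assoc, sum_mul_conjTranspose_mul hW]
  rw [Matrix.conjTranspose_sub, hH, Matrix.conjTranspose_one, sub_mul, mul_sub, mul_sub, hG]
  simp

theorem isZUS_of_isometries {m : ℕ} [NeZero a]
    (hW : ∀ s t, (W s)ᴴ * W t = if s = t then 1 else 0)
    (hρ : (∑ s, c s • vecKetBra (W s)).trace = 1) (B : BasisSet m a) :
    IsZUS B (∑ s, c s • vecKetBra (W s)) := by
  intro x
  set P : Fin a → Matrix (Fin a) (Fin a) ℂ := fun k => (ketBra (B x k))ᵀ with hP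
  have hPsum : ∑ k, P k = 1 := by
    rw [hP, ← Matrix.transpose_sum, (B x).sum_ketBra, Matrix.transpose_one]
  have hPP : ∀ k, P k * P k = P k := by
    intro k
    have h : ketBra (B x k) * ketBra (B x k) = ketBra (B x k) := by
      rw [ketBra_eq_vecMulVec, Matrix.vecMulVec_mul_vecMulVec, star_dotProduct_ofLp,
        inner_self_eq_norm_sq_to_K, (B x).norm_eq_one]
      simp
    simp only [hP]
    rw [← Matrix.transpose_mul, h]
  have hPpos : ∀ k, (P k).PosSemidef := fun k => by
    simp only [hP, transpose_ketBra]
    exact Matrix.posSemidef_vecMulVec_self_star _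
  set G := 1 - ∑ t, W t * (W t)ᴴ with hG
  have hGW : ∀ s, G * W s = 0 := fun s => by
    rw [hG, Matrix.sub_mul, sum_mul_conjTranspose_mul hW, Matrix.one_mul, sub_self]
  have hGpos : G.PosSemidef := by
    rw [hG, ← conjTranspose_mul_self_one_sub_sum hW]
    exact Matrix.posSemidef_conjTranspose_mul_self _
  -- Alice's transposed projectors are carried into each range. The complement `G`, which never
  -- occurs on this state, is assigned arbitrarily to outcome `0`.
  set E : Fin a → Matrix (Fin b) (Fin b) ℂ :=
    fun k => ∑ t, W t * P k * (W t)ᴴ + if k = 0 then G else 0 with hE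
  have hEW : ∀ k s, E k * W s = W s * P k := by
    intro k s
    simp only [hE]
    have h0 : (if k = 0 then G else 0) * W s = 0 := by split_ifs <;> simp [hGW]
    rw [Matrix.add_mul, Matrix.sum_mul, h0, add_zero]
    rw [Finset.sum_eq_single s
      (fun t _ ht => by rw [Matrix.mul_assoc, hW, if_neg ht, Matrix.mul_zero]) (by simp),
      Matrix.mul_assoc, hW, if_pos rfl, Matrix.mul_one]
  refine ⟨E, ⟨fun k => ?_, ?_⟩, ?_⟩
  · refine Matrix.PosSemidef.add (Matrix.posSemidef_sum _ fun t _ =>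
      (hPpos k).mul_mul_conjTranspose_same (W t)) ?_
    split_ifs
    · exact hGpos
    · exact Matrix.PosSemidef.zero
  · simp only [hE]
    rw [Finset.sum_add_distrib, Finset.sum_comm]
    simp only [← Matrix.sum_mul, ← Matrix.mul_sum, hPsum, Matrix.mul_one]
    simp [hG]
  · have hterm : ∀ k, ((∑ s, c s • vecKetBra (W s)) * (ketBra (B x k) ⊗ₖ E k)).trace =
        ∑ s, c s * (P k).trace := by
      intro k
      rw [Matrix.sum_mul, Matrix.trace_sum]
      refine Finset.sum_congr rfl fun s _ => ?_
      rw [Matrix.smul_mul, Matrix.trace_smul, trace_vecKetBra_mul_kronecker, hEW, Matrix.mul_assoc]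
      change c s • ((W s)ᴴ * (W s * (P k * P k))).trace = _
      rw [hPP, ← Matrix.mul_assoc, hW, if_pos rfl, Matrix.one_mul, smul_eq_mul]
    rw [guessProb]
    simp only [hterm]
    rw [Finset.sum_comm]
    simp only [← Finset.mul_sum, ← Matrix.trace_sum, hPsum]
    rw [← hρ, trace_sum_smul_vecKetBra hW, ← Finset.sum_mul, Matrix.trace_one, Fintype.card_fin,
      mul_comm]

/-- Teleportation: every state can be created from a mixture of locally distinguishable maximally
entangled states. -/
theorem isMES_of_isometries [NeZero a]
    (hW : ∀ s t, (W s)ᴴ * W t = if s = t then 1 else 0)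
    (hρ : IsState (∑ s, c s • vecKetBra (W s))) : IsMES (∑ s, c s • vecKetBra (W s)) := by
  refine ⟨hρ, fun σ hσ => ?_⟩
  obtain ⟨Y, hY, -⟩ := exists_eq_sum_vecKetBra hσ.1
  obtain ⟨V, hV, hVX⟩ := exists_unitary_oneDesign a
  have ha : (a : ℂ) ≠ 0 := Nat.cast_ne_zero.2 (NeZero.ne a)
  have hVV : ∀ j, V j * (V j)ᴴ = 1 := fun j => mul_eq_one_comm.1 (hV j)
  set z : ℂ := (((√(a : ℝ))⁻¹ : ℝ) : ℂ) with hz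
  have hzz : star z * z = (a : ℂ)⁻¹ := by
    rw [hz, RCLike.star_def, Complex.conj_ofReal, ← Complex.ofReal_mul, ← mul_inv,
      Real.mul_self_sqrt (Nat.cast_nonneg a)]
    simp
  set G := 1 - ∑ t, W t * (W t)ᴴ with hG
  have hGW : ∀ s, G * W s = 0 := fun s => by
    rw [hG, Matrix.sub_mul, sum_mul_conjTranspose_mul hW, Matrix.one_mul, sub_self]
  -- Bob identifies `t`, undoes `W t`, and applies the Weyl operator `V j` followed by a term `Y q`
  -- of the target. The outcome `none` covers the complement of the ranges. The 1-design property
  -- and the trace of the target fix `z` at `1/√a`.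
  let K : Option ((Fin a × Fin a) × (Fin a × Fin b) × κ) → Matrix (Fin b) (Fin b) ℂ :=
    fun i => i.elim G fun i => z • (Y i.2.1 * V i.1 * (W i.2.2)ᴴ)
  let U : Option ((Fin a × Fin a) × (Fin a × Fin b) × κ) → Matrix (Fin a) (Fin a) ℂ :=
    fun i => i.elim 1 fun i => ((V i.1)ᴴ)ᵀ
  have hU : ∀ i, (U i)ᴴ * U i = 1 := by
    rintro (_ | i)
    · simp [U]
    · have h : (((V i.1)ᴴ)ᵀ)ᴴ = (V i.1)ᵀ := by
        ext k l
        simp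
      change (((V i.1)ᴴ)ᵀ)ᴴ * ((V i.1)ᴴ)ᵀ = 1
      rw [h, ← Matrix.transpose_mul, hV, Matrix.transpose_one]
  have hYtr : (∑ q, (Y q)ᴴ * Y q).trace = 1 := by
    rw [← hσ.2, hY, Matrix.trace_sum, Matrix.trace_sum]
    exact Finset.sum_congr rfl fun q _ => (trace_vecKetBra _).symm
  have hsplit : ∀ {M : Type} [AddCommMonoid M] (f : (Fin a × Fin a) × (Fin a × Fin b) × κ → M),
      ∑ i, f i = ∑ t, ∑ j, ∑ q, f (j, q, t) := by
    intro M _ f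
    rw [Fintype.sum_prod_type, Finset.sum_comm (s := (Finset.univ : Finset κ))]
    exact Finset.sum_congr rfl fun j _ => Fintype.sum_prod_type_right _
  have hK : ∑ i, (K i)ᴴ * K i = 1 := by
    rw [Fintype.sum_option]
    have h1 : (K none)ᴴ * K none = G := conjTranspose_mul_self_one_sub_sum hW
    have h2 : ∀ j q t, (K (some (j, q, t)))ᴴ * K (some (j, q, t)) =
        (a : ℂ)⁻¹ • (W t * ((V j)ᴴ * ((Y q)ᴴ * Y q) * V j) * (W t)ᴴ) := by
      intro j q t
      change (z • (Y q * V j * (W t)ᴴ))ᴴ * (z • (Y q * V j * (W t)ᴴ)) = _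
      rw [Matrix.conjTranspose_smul, Matrix.smul_mul, Matrix.mul_smul, smul_smul, hzz]
      simp only [Matrix.conjTranspose_mul, Matrix.conjTranspose_conjTranspose, Matrix.mul_assoc]
    have h3 : ∑ i, (K (some i))ᴴ * K (some i) = ∑ t, W t * (W t)ᴴ := by
      rw [hsplit]
      simp only [h2, ← Finset.smul_sum, ← Matrix.sum_mul, ← Matrix.mul_sum, hVX, hYtr]
      rw [Finset.smul_sum]
      refine Finset.sum_congr rfl fun t _ => ?_
      rw [mul_one, Matrix.mul_smul, Matrix.mul_one, Matrix.smul_mul, smul_smul,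
        inv_mul_cancel₀ ha, one_smul]
    rw [h1, h3, hG]
    simp
  refine ⟨_, isLOCC_of_isometry_kronecker U K hU hK, ?_⟩
  have hterm : ∀ i, (U i ⊗ₖ K i) * (∑ s, c s • vecKetBra (W s)) * (U i ⊗ₖ K i)ᴴ =
      ∑ s, c s • vecKetBra (K i * W s * (U i)ᵀ) := by
    intro i
    rw [Matrix.mul_sum, Matrix.sum_mul]
    refine Finset.sum_congr rfl fun s _ => ?_
    rw [Matrix.mul_smul, Matrix.smul_mul, kronecker_mul_vecKetBra_mul]
  have hnone : ∀ s, K none * W s * (U none)ᵀ = 0 := fun s => by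
    change G * W s * _ = 0
    rw [hGW, Matrix.zero_mul]
  -- Only `t = s` contributes, and Alice's correction cancels `V j`: the result does not depend on
  -- `j`.
  have hsome : ∀ j q t s, K (some (j, q, t)) * W s * (U (some (j, q, t)))ᵀ =
      if t = s then z • Y q else 0 := by
    intro j q t s
    change z • (Y q * V j * (W t)ᴴ) * W s * (((V j)ᴴ)ᵀ)ᵀ = _
    rw [Matrix.transpose_transpose, Matrix.smul_mul, Matrix.smul_mul, Matrix.mul_assoc _ _ (W s), hW]
    split_ifs
    · rw [Matrix.mul_one, Matrix.mul_assoc, hVV, Matrix.mul_one]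
    · simp
  have hcsum : (a : ℂ) * ∑ s, c s = 1 := by rw [← trace_sum_smul_vecKetBra hW, hρ.2]
  simp only [hterm]
  rw [Fintype.sum_option]
  simp only [hnone, vecKetBra_zero, smul_zero, Finset.sum_const_zero, zero_add]
  rw [hsplit]
  simp only [hsome, apply_ite vecKetBra, vecKetBra_zero, smul_ite, smul_zero, Finset.sum_ite_eq,
    Finset.mem_univ, if_true, vecKetBra_smul, mul_comm z, hzz, ← Finset.smul_sum, ← hY]
  -- There are `a ^ 2` values of `j`, each with weight `1/a`, and `∑ s, c s = 1/a`.
  rw [← Finset.sum_smul, Finset.sum_const, Finset.card_univ, Fintype.card_prod, Fintype.card_fin,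
    ← Nat.cast_smul_eq_nsmul ℂ, smul_smul, smul_smul]
  convert one_smul ℂ σ using 2
  rw [← hcsum]
  push_cast
  field_simp

end Isometries

/-! ### Maximal entanglement implies isotropy -/

/-- Every ensemble of a maximally entangled state is isotropic. -/
theorem IsMES.isIsotropicEnsemble {a b : ℕ} [NeZero a] (hab : a ≤ b) {ι : Type} [Fintype ι]
    {N : ι → Matrix (Fin b) (Fin a) ℂ} (h : IsMES (∑ s, vecKetBra (N s))) :
    IsIsotropicEnsemble N := by
  have ha : (a : ℂ) ≠ 0 := Nat.cast_ne_zero.2 (NeZero.ne a)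
  -- The target is the normalized coordinate embedding, available because `a ≤ b`.
  set J : Matrix (Fin b) (Fin a) ℂ := (((√(a : ℝ))⁻¹ : ℝ) : ℂ) •
    (1 : Matrix (Fin b) (Fin b) ℂ).submatrix id (Fin.castLE hab) with hJdef
  have hJ : Jᴴ * J = (a : ℂ)⁻¹ • 1 := by
    rw [hJdef, Matrix.conjTranspose_smul, Matrix.smul_mul, Matrix.mul_smul, smul_smul,
      RCLike.star_def, Complex.conj_ofReal, ← Complex.ofReal_mul, ← mul_inv,
      Real.mul_self_sqrt (Nat.cast_nonneg a), Matrix.conjTranspose_submatrix,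
      Matrix.conjTranspose_one, ← Matrix.submatrix_mul _ _ _ id _ Function.bijective_id,
      Matrix.one_mul, Matrix.submatrix_one _ (Fin.castLE_injective hab)]
    simp
  have hJtr : (Jᴴ * J).trace = 1 := by
    rw [hJ, Matrix.trace_smul, Matrix.trace_one, Fintype.card_fin, smul_eq_mul, inv_mul_cancel₀ ha]
  obtain ⟨T, hT, hTJ⟩ := h.2 (vecKetBra J)
    ⟨posSemidef_vecKetBra J, by rw [trace_vecKetBra, hJtr]⟩
  obtain ⟨κ, _, A, K, hAK, hTeq⟩ := hT.exists_separable
  rw [hTeq] at hTJ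
  simp only [Matrix.mul_sum, Matrix.sum_mul, kronecker_mul_vecKetBra_mul] at hTJ
  rw [← Fintype.sum_prod_type' (f := fun i s => vecKetBra (K i * N s * (A i)ᵀ))] at hTJ
  choose z hz using fun i s => exists_eq_smul_of_sum_vecKetBra_eq
    (N := fun p : κ × ι => K p.1 * N p.2 * (A p.1)ᵀ) hJtr hTJ (i, s)
  simp only at hz
  -- The completeness relation of the separable map, applied to the vectorization of `N s`.
  have hres : ∀ s, ∑ i, (K i)ᴴ * K i * N s * ((A i)ᴴ * A i)ᵀ = N s := by
    intro s
    apply Matrix.vec_inj.1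
    rw [Matrix.vec_sum]
    simp only [← Matrix.kronecker_mulVec_vec]
    rw [← Matrix.sum_mulVec, hAK, Matrix.one_mulVec]
  intro t s
  have hadj : ∀ i t, ((A i)ᵀ)ᴴ * ((K i * N t)ᴴ * J) = (star (z i t) * (a : ℂ)⁻¹) • 1 := by
    intro i t
    rw [← Matrix.mul_assoc, ← Matrix.conjTranspose_mul, hz, Matrix.conjTranspose_smul,
      Matrix.smul_mul, hJ, smul_smul]
  have hterm : ∀ i, (N t)ᴴ * ((K i)ᴴ * K i * N s * ((A i)ᴴ * A i)ᵀ) =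
      (z i s * (star (z i t) * (a : ℂ)⁻¹)) • 1 := by
    intro i
    have hAA : ((A i)ᴴ * A i)ᵀ = (A i)ᵀ * ((A i)ᵀ)ᴴ := by
      rw [Matrix.transpose_mul]; rfl
    have h1 : (N t)ᴴ * ((K i)ᴴ * K i * N s * ((A i)ᴴ * A i)ᵀ) =
        (K i * N t)ᴴ * (K i * N s * (A i)ᵀ) * ((A i)ᵀ)ᴴ := by
      rw [hAA, Matrix.conjTranspose_mul]
      simp only [Matrix.mul_assoc]
    rw [h1, hz, Matrix.mul_smul, Matrix.smul_mul]
    -- If `z i s ≠ 0`, then `hadj` for `s` gives the square matrix `((A i)ᵀ)ᴴ` a one-sided, hence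
    -- two-sided, inverse. The two factors in `hadj` for `t`, whose product is scalar, may then be
    -- exchanged.
    by_cases h0 : z i s = 0
    · simp [h0]
    · set X := (K i * N s)ᴴ * J with hX
      have hw : star (z i s) * (a : ℂ)⁻¹ ≠ 0 :=
        mul_ne_zero (star_ne_zero.2 h0) (inv_ne_zero ha)
      have hinv : ((star (z i s) * (a : ℂ)⁻¹)⁻¹ • X) * ((A i)ᵀ)ᴴ = 1 := by
        rw [mul_eq_one_comm, Matrix.mul_smul, hadj, smul_smul, inv_mul_cancel₀ hw, one_smul]
      have hcomm : (K i * N t)ᴴ * J * ((A i)ᵀ)ᴴ = (star (z i t) * (a : ℂ)⁻¹) • 1 := by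
        calc (K i * N t)ᴴ * J * ((A i)ᵀ)ᴴ
            = ((star (z i s) * (a : ℂ)⁻¹)⁻¹ • X) * (((A i)ᵀ)ᴴ * ((K i * N t)ᴴ * J)) *
                ((A i)ᵀ)ᴴ := by
              rw [← Matrix.mul_assoc, hinv, Matrix.one_mul]
          _ = _ := by
              rw [hadj, Matrix.mul_smul, Matrix.mul_one, Matrix.smul_mul, hinv]
      rw [hcomm, smul_smul]
  refine ⟨∑ i, z i s * (star (z i t) * (a : ℂ)⁻¹), ?_⟩
  rw [Finset.sum_smul]
  conv_lhs => rw [← hres s, Matrix.mul_sum]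
  exact Finset.sum_congr rfl fun i _ => hterm i

/-! ### The equivalence -/

theorem theorem1 {m dA dB : ℕ} (B : BasisSet m dA) (hB : IsIrreducibleBasisSet B)
    (ρ : BipartiteOp dA dB) (hρ : IsState ρ) :
    IsZUS B ρ ↔ dA ≤ dB ∧ IsMES ρ := by
  obtain ⟨v⟩ := hB.nonempty
  -- A connected graph has a vertex, which excludes dimension zero.
  have : NeZero dA := ⟨fun h => (v.2.cast h).elim0⟩
  obtain ⟨N, rfl, horth⟩ := exists_eq_sum_vecKetBra hρ.1
  constructor
  · intro h
    obtain ⟨κ, _, _, c, W, hW, heq⟩ := (h.isIsotropicEnsemble hB hρ.2).exists_isometries horth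
    rw [heq] at hρ ⊢
    refine ⟨?_, isMES_of_isometries hW hρ⟩
    -- An empty mixture would have trace zero.
    have : Nonempty κ := by
      by_contra hκ
      rw [not_nonempty_iff] at hκ
      simpa using hρ.2
    obtain ⟨s⟩ := this
    exact le_of_conjTranspose_mul_self_eq_one (W := W s) (by rw [hW, if_pos rfl])
  · rintro ⟨hab, h⟩
    obtain ⟨κ, _, _, c, W, hW, heq⟩ := (h.isIsotropicEnsemble hab).exists_isometries horth
    rw [heq] at hρ ⊢
    exact isZUS_of_isometries hW hρ.2 B
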